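/- All graphs are finite and simple, and equality of graphs means isomorphism. Write $O_m$ for the empty (edgeless) graph on $m$ vertices, $G_1+G_2$ for the disjoint union of $G_1$ and $G_2$, and $G_1\vee G_2$ for their join (the disjoint union together with all edges between $G_1$ and $G_2$). Let $\delta(G)$ be the minimum degree of $G$, $\overline{G}$ its complement, and $\mu(\overline{G})$ the largest eigenvalue of the adjacency matrix of $\overline{G}$. A graph is Hamilton-connected if every two distinct vertices are the ends of a Hamiltonian path. For even $n$, let $ES_n$ be the set consisting of the complete bipartite graph $K_{n/2,n/2}$ and of all graphs $G_1\vee G_2$ where, for some integer $r$ with $1\le r\le n/2$, $G_1$ is a regular graph of order $n-r$ and degree $n/2-r$, and $G_2$ is an arbitrary graph of order $r$. **Theorem 2.12.** Let $k\ge 2$ and let $G$ be a graph of order $n\ge 2k$ with $\delta(G)\ge k$ and $$\mu(\overline{G})\le\sqrt{(k-1)(n-k-1)}.$$ Then $G$ is Hamilton-connected, unless $G=(K_{k-1}+K_{n-k-1})\vee K_2$, or $G=(K_{k-1}+K_{n-k-1})\vee O_2$, or $n=2k$ and $G\in ES_n$. -/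

import Mathlib

namespace SimpleGraph

/-- The join `G ∨ H`: the disjoint union of `G` and `H` together with all edges between them. -/
def join {V W : Type*} (G : SimpleGraph V) (H : SimpleGraph W) : SimpleGraph (V ⊕ W) :=
  (G ⊕g H) ⊔ completeBipartiteGraph V W

open Classical in
/-- The largest eigenvalue of the adjacency matrix of `G` over the reals
(attained as soon as `G` has a vertex, see `isGreatest_adjSpectralRadius`). -/
noncomputable def adjSpectralRadius {V : Type*} [Fintype V] (G : SimpleGraph V) : ℝ :=
  sSup {x : ℝ | Module.End.HasEigenvalue (Matrix.toLin' (G.adjMatrix ℝ)) x}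

open Classical in
theorem isGreatest_adjSpectralRadius {V : Type*} [Fintype V] [Nonempty V] (G : SimpleGraph V) :
    IsGreatest {x : ℝ | Module.End.HasEigenvalue (Matrix.toLin' (G.adjMatrix ℝ)) x}
      G.adjSpectralRadius := by
  have hA : (G.adjMatrix ℝ).IsHermitian := by
    rw [Matrix.IsHermitian, Matrix.conjTranspose_eq_transpose_of_trivial]
    exact G.isSymm_adjMatrix
  have hfin : {x : ℝ | Module.End.HasEigenvalue (Matrix.toLin' (G.adjMatrix ℝ)) x}.Finite :=
    Module.End.finite_hasEigenvalue _
  obtain ⟨v⟩ := ‹Nonempty V›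
  have hne : {x : ℝ | Module.End.HasEigenvalue (Matrix.toLin' (G.adjMatrix ℝ)) x}.Nonempty := by
    refine ⟨hA.eigenvalues v, ?_⟩
    refine Module.End.hasEigenvalue_of_hasEigenvector
      (x := (hA.eigenvectorBasis v).ofLp) ⟨?_, ?_⟩
    · rw [Module.End.mem_eigenspace_iff, Matrix.toLin'_apply]
      exact hA.mulVec_eigenvectorBasis v
    · intro h
      exact hA.eigenvectorBasis.orthonormal.ne_zero v (by ext i; exact congrFun h i)
  exact ⟨hne.csSup_mem hfin, fun x hx => le_csSup hfin.bddAbove hx⟩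

open Classical in
/-- Every two distinct vertices of `G` are the ends of a Hamiltonian path. -/
def IsHamiltonConnected {V : Type*} (G : SimpleGraph V) : Prop :=
  ∀ u v : V, u ≠ v → ∃ p : G.Walk u v, p.IsHamiltonian

open Classical in
/-- `G` is, up to isomorphism, a member of the family `ES_n` of graphs of even order `n`:
either `K_{n/2,n/2}`, or a join `G₁ ∨ G₂` with `1 ≤ r ≤ n/2`, where `G₁` has order `n - r` and is
regular of degree `n/2 - r`, and `G₂` is any graph of order `r`. -/
def MemES {V : Type*} (n : ℕ) (G : SimpleGraph V) : Prop :=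
  Even n ∧
    (Nonempty (G ≃g completeBipartiteGraph (Fin (n / 2)) (Fin (n / 2))) ∨
      ∃ r : ℕ, 1 ≤ r ∧ r ≤ n / 2 ∧
        ∃ (G₁ : SimpleGraph (Fin (n - r))) (G₂ : SimpleGraph (Fin r)),
          G₁.IsRegularOfDegree (n / 2 - r) ∧ Nonempty (G ≃g G₁.join G₂))

end SimpleGraph

/-!
Suppose that `G` has no Hamiltonian path from `u` to `v`, and add edges until any further edge would
create one. In the saturated graph `H`, a Hamiltonian path of `H + xy` through a nonedge `xy` cannot
be rerouted around that edge, and counting positions as in Ore's theorem gives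
`d(x) + d(y) ≤ n`, and even `≤ n - 1` when `xy` meets `{u, v}`
(`SimpleGraph.exists_ge_ne_top_degree_add_degree_le`). In the complement `B` of `H` every edge
therefore has degree sum at least `n - 2`, and at least `n - 1` if it meets `{u, v}`. All degrees of
`B` are at most `n - k - 1` because `δ(G) ≥ k`, so the product of the degrees along an edge is at
least `(k - 1)(n - k - 1) =: s²` (`SimpleGraph.mul_le_mul_and_eq_of_add_le_add`).

On the other hand `B` is contained in the complement `A` of `G`, whose spectral radius is at most
`s`. Evaluating the quadratic form of `A` at the vector `√(deg_B)` gives at least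
`2 ∑ √(d(a) d(b)) ≥ 2 s |E(B)|`, the sum running over the edges of `B`, while the squared norm of
the vector is `2 |E(B)|`. Hence equality holds throughout
(`SimpleGraph.degree_mul_degree_eq_and_adj_of_adjSpectralRadius_le`): each edge of `B` has degrees
`k - 1` and `n - k - 1`, and a vertex that is not isolated in `B` has the same neighbours in `A` as
in `B`. In particular `u` and `v` are isolated in `B`.

If `n = 2k`, the vertices not isolated in `B` induce a regular graph and are joined in `G` to all
the others, so `G` belongs to `ES_n` by the second clause of its definition; this covers `K_{k,k}`,
where `r = k`. Otherwise the endpoints of an edge of `B` have disjoint neighbourhoods with `n - 2`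
elements in all, which leaves only `u` and `v`, and `B` is complete bipartite between them.
-/

namespace SimpleGraph

/-! ### Spectral radius and degrees of a subgraph -/

open Matrix

open Classical in
theorem posSemidef_sub_adjMatrix {V : Type*} [Fintype V] (A : SimpleGraph V) {s : ℝ}
    (hs : A.adjSpectralRadius ≤ s) :
    (s • (1 : Matrix V V ℝ) - A.adjMatrix ℝ).PosSemidef := by
  have hM : (s • (1 : Matrix V V ℝ) - A.adjMatrix ℝ).IsHermitian := by
    rw [Matrix.IsHermitian, Matrix.conjTranspose_eq_transpose_of_trivial, Matrix.transpose_sub,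
      Matrix.transpose_smul, Matrix.transpose_one, A.isSymm_adjMatrix]
  rw [hM.posSemidef_iff_eigenvalues_nonneg]
  intro i
  have : Nonempty V := ⟨i⟩
  have hx := hM.mulVec_eigenvectorBasis i
  set x := hM.eigenvectorBasis i with hxdef
  have hA : Module.End.HasEigenvalue (Matrix.toLin' (A.adjMatrix ℝ)) (s - hM.eigenvalues i) := by
    refine Module.End.hasEigenvalue_of_hasEigenvector (x := x.ofLp) ⟨?_, ?_⟩
    · rw [Module.End.mem_eigenspace_iff, Matrix.toLin'_apply]
      rw [Matrix.sub_mulVec, Matrix.smul_mulVec, Matrix.one_mulVec] at hx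
      rw [sub_smul, ← hx]
      abel
    · intro h
      exact hM.eigenvectorBasis.orthonormal.ne_zero i (by ext j; exact congrFun h j)
  have := A.isGreatest_adjSpectralRadius.2 hA
  simp only [Pi.zero_apply]
  linarith

open Classical in
/-- The equality case of `min √(d(a) d(b)) ≤ μ`, the minimum taken over the edges `ab` of a subgraph
`B` of `A`: all these products then agree, and no edge of `A` outside `B` meets a vertex that is
not isolated in `B`. The witness is the vector `a ↦ √(deg_B a)`, on which the positive semidefinite
form of `s - A` is nonpositive, hence zero, so that the vector lies in the kernel. -/
theorem degree_mul_degree_eq_and_adj_of_adjSpectralRadius_le {V : Type*} [Fintype V]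
    {A B : SimpleGraph V} (hBA : B ≤ A) {s : ℝ} (hs : 0 ≤ s) (hA : A.adjSpectralRadius ≤ s)
    (hB : ∀ a b, B.Adj a b → s ^ 2 ≤ (B.degree a : ℝ) * B.degree b) :
    (∀ a b, B.Adj a b → (B.degree a : ℝ) * B.degree b = s ^ 2) ∧
      ∀ a b, A.Adj a b → 0 < B.degree a → B.Adj a b := by
  have hM := A.posSemidef_sub_adjMatrix hA
  set x : V → ℝ := fun a => √(B.degree a) with hx
  have hx0 : ∀ a, 0 ≤ x a := fun a => Real.sqrt_nonneg _
  have hxx : ∀ a, x a * x a = B.degree a := fun a => Real.mul_self_sqrt (Nat.cast_nonneg _)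
  -- Termwise, the quadratic form of `s - A` at `x` is a sum of nonpositive numbers.
  set t : V → V → ℝ := fun a b =>
    (if B.Adj a b then s else 0) - (if A.Adj a b then x a * x b else 0) with ht
  have hle : ∀ a b, B.Adj a b → s ≤ x a * x b := fun a b h => by
    refine (pow_le_pow_iff_left₀ hs (mul_nonneg (hx0 a) (hx0 b)) two_ne_zero).1 ?_
    calc s ^ 2 ≤ _ := hB a b h
      _ = (x a * x b) ^ 2 := by rw [← hxx, ← hxx]; ring
  have htn : ∀ a b, t a b ≤ 0 := fun a b => by
    by_cases h : B.Adj a b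
    · simpa [ht, h, hBA h] using hle a b h
    · simp only [ht, h, if_false, zero_sub, Left.neg_nonpos_iff]
      split_ifs
      exacts [mul_nonneg (hx0 a) (hx0 b), le_rfl]
  have hMa : ∀ a, ((s • (1 : Matrix V V ℝ) - A.adjMatrix ℝ) *ᵥ x) a =
      s * x a - ∑ b, if A.Adj a b then x b else 0 := fun a => by
    rw [Matrix.sub_mulVec, Matrix.smul_mulVec, Matrix.one_mulVec]
    simp [Matrix.mulVec, dotProduct, adjMatrix_apply]
  have hq : star x ⬝ᵥ ((s • (1 : Matrix V V ℝ) - A.adjMatrix ℝ) *ᵥ x) = ∑ a, ∑ b, t a b := by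
    refine Finset.sum_congr rfl fun a _ => ?_
    rw [hMa, ht, Finset.sum_sub_distrib, mul_sub, Finset.mul_sum]
    congr 1
    · rw [Finset.sum_ite, Finset.sum_const, Finset.sum_const_zero, add_zero,
        ← neighborFinset_eq_filter, card_neighborFinset_eq_degree, nsmul_eq_mul, ← hxx]
      simp only [Pi.star_apply, star_trivial]
      ring
    · refine Finset.sum_congr rfl fun b _ => ?_
      simp
  have hq0 : ∑ a, ∑ b, t a b = 0 :=
    le_antisymm (Finset.sum_nonpos fun a _ => Finset.sum_nonpos fun b _ => htn a b)
      (hq ▸ hM.dotProduct_mulVec_nonneg x)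
  have hker := (hM.dotProduct_mulVec_zero_iff x).1 (hq.trans hq0)
  have ht0 : ∀ a b, t a b = 0 := fun a b => by
    have h1 := (Finset.sum_eq_zero_iff_of_nonpos
      (fun a _ => Finset.sum_nonpos fun b _ => htn a b)).1 hq0 a (Finset.mem_univ a)
    exact (Finset.sum_eq_zero_iff_of_nonpos fun b _ => htn a b).1 h1 b (Finset.mem_univ b)
  refine ⟨fun a b h => ?_, fun a b h ha => ?_⟩
  · have h0 := ht0 a b
    simp only [ht, h, hBA h, if_true] at h0
    rw [sub_eq_zero.1 h0, ← hxx, ← hxx]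
    ring
  · by_contra hab
    have hxa : 0 < x a := Real.sqrt_pos.2 (Nat.cast_pos.2 ha)
    have h0 := ht0 a b
    simp only [ht, h, hab, if_true, if_false, zero_sub, neg_eq_zero, mul_eq_zero, hxa.ne',
      false_or] at h0
    -- The eigenvector equation at `b` forces `x` to vanish at every `A`-neighbour of `b`.
    have hb := congrFun hker b
    rw [hMa, h0, mul_zero, zero_sub, Pi.zero_apply, neg_eq_zero, Finset.sum_eq_zero_iff_of_nonneg
      (fun c _ => by split_ifs; exacts [hx0 c, le_rfl])] at hb
    have := hb a (Finset.mem_univ a)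
    rw [if_pos h.symm] at this
    exact hxa.ne' this

/-! ### Hamiltonian paths and degree sums -/

/-- A Hamiltonian path from `u` to `v` given by the sequence `p 0, …, p (n - 1)` of its vertices. It is
used for `n` the number of vertices, so that injectivity makes it visit all of them; the values of
`p` from `n` on are irrelevant. -/
structure IsHamiltonianSeq {V : Type*} (G : SimpleGraph V) (u v : V) (n : ℕ) (p : ℕ → V) :
    Prop where
  injOn : Set.InjOn p (Set.Iio n)
  first : p 0 = u
  last : p (n - 1) = v
  adj : ∀ i, i + 1 < n → G.Adj (p i) (p (i + 1))

theorem exists_walk_support_eq_map_range {V : Type*} {G : SimpleGraph V} (p : ℕ → V) (m : ℕ)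
    (h : ∀ i < m, G.Adj (p i) (p (i + 1))) :
    ∃ w : G.Walk (p 0) (p m), w.support = (List.range (m + 1)).map p := by
  induction m with
  | zero => exact ⟨.nil, by simp⟩
  | succ m ih =>
    obtain ⟨w, hw⟩ := ih fun i hi => h i (by lia)
    refine ⟨w.concat (h m (by lia)), ?_⟩
    rw [Walk.support_concat, hw, List.range_succ (n := m + 1), List.map_append]
    simp

/-- Reversing the segment `p a, …, p b` replaces the two steps at its ends by the chords
`p (a - 1) p b` and `p a p (b + 1)`, so those two steps need not be edges of `G`. -/
theorem isHamiltonianSeq_reverse_segment {V : Type*} {G : SimpleGraph V}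
    {u v : V} {n : ℕ} {p : ℕ → V} {a b : ℕ}
    (hinj : Set.InjOn p (Set.Iio n)) (h0 : p 0 = u) (h1 : p (n - 1) = v)
    (ha : 0 < a) (hab : a ≤ b) (hb : b + 1 < n)
    (hadj : ∀ i, i + 1 < n → i + 1 ≠ a → i ≠ b → G.Adj (p i) (p (i + 1)))
    (hab₁ : G.Adj (p (a - 1)) (p b)) (hab₂ : G.Adj (p a) (p (b + 1))) :
    G.IsHamiltonianSeq u v n (fun i => p (if a ≤ i ∧ i ≤ b then a + b - i else i)) := by
  refine ⟨fun i hi j hj h => ?_, ?_, ?_, fun i hi => ?_⟩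
  · simp only [Set.mem_Iio] at hi hj
    have := hinj (x₁ := if a ≤ i ∧ i ≤ b then a + b - i else i)
      (x₂ := if a ≤ j ∧ j ≤ b then a + b - j else j)
      (by simp only [Set.mem_Iio]; split_ifs <;> lia)
      (by simp only [Set.mem_Iio]; split_ifs <;> lia) h
    split_ifs at this <;> lia
  · rw [if_neg (by lia), h0]
  · rw [if_neg (by lia), h1]
  · rcases lt_trichotomy (i + 1) a with h | h | h
    · rw [if_neg (by lia), if_neg (by lia)]
      exact hadj i hi (by lia) (by lia)
    · rw [if_neg (by lia), if_pos (by lia), show a + b - (i + 1) = b by lia,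
        show i = a - 1 by lia]
      exact hab₁
    · rcases lt_trichotomy i b with h' | h' | h'
      · rw [if_pos (by lia), if_pos (by lia),
          show a + b - i = (a + b - (i + 1)) + 1 by lia]
        exact (hadj _ (by lia) (by lia) (by lia)).symm
      · rw [if_pos (by lia), if_neg (by lia), show a + b - i = a by lia, h']
        exact hab₂
      · rw [if_neg (by lia), if_neg (by lia)]
        exact hadj i hi (by lia) (by lia)

section Fintype

variable {V : Type*} [Fintype V] {G : SimpleGraph V} {u v : V} {n : ℕ}

theorem exists_lt_apply_eq_of_injOn {p : ℕ → V} (hinj : Set.InjOn p (Set.Iio n))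
    (hV : Fintype.card V = n) (a : V) : ∃ i < n, p i = a := by
  have : Function.Bijective fun i : Fin n => p i :=
    (Fintype.bijective_iff_injective_and_card _).2
      ⟨fun i j h => Fin.ext (hinj i.2 j.2 h), by simp [hV]⟩
  obtain ⟨i, hi⟩ := this.2 a
  exact ⟨i, i.2, hi⟩

open Classical in
theorem IsHamiltonianSeq.exists_isHamiltonian {p : ℕ → V} (hp : G.IsHamiltonianSeq u v n p)
    (hV : Fintype.card V = n) : ∃ w : G.Walk u v, w.IsHamiltonian := by
  obtain ⟨w, hw⟩ := exists_walk_support_eq_map_range (G := G) p (n - 1)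
    fun i hi => hp.adj i (by lia)
  have hn : n - 1 + 1 = n := by
    have : Nonempty V := ⟨u⟩
    have := Fintype.card_pos (α := V)
    lia
  rw [hn] at hw
  have hpath : w.IsPath := by
    refine .mk' ?_
    rw [hw]
    refine (List.nodup_map_iff_inj_on List.nodup_range).2 fun i hi j hj h => ?_
    exact hp.injOn (List.mem_range.1 hi) (List.mem_range.1 hj) h
  have hham : w.IsHamiltonian := hpath.isHamiltonian_of_mem fun a => by
    obtain ⟨i, hi, rfl⟩ := exists_lt_apply_eq_of_injOn hp.injOn hV a
    rw [hw]
    exact List.mem_map_of_mem (List.mem_range.2 hi)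
  have h0 := hp.first
  have h1 := hp.last
  subst h0 h1
  exact ⟨w, hham⟩

theorem exists_isHamiltonianSeq_top (huv : u ≠ v) (hV : Fintype.card V = n) :
    ∃ p, (⊤ : SimpleGraph V).IsHamiltonianSeq u v n p := by
  classical
  have : Nontrivial V := ⟨u, v, huv⟩
  have hn : 1 < n := hV ▸ Fintype.one_lt_card
  let e := (Fintype.equivFinOfCardEq hV).symm
  let e₁ := e.trans (Equiv.swap (e ⟨0, by lia⟩) u)
  let e₂ := e₁.trans (Equiv.swap (e₁ ⟨n - 1, by lia⟩) v)
  have h₁ : e₁ ⟨0, by lia⟩ = u := by simp [e₁]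
  have h₂ : e₂ ⟨0, by lia⟩ = u := by
    simp only [e₂, Equiv.trans_apply, h₁]
    refine Equiv.swap_apply_of_ne_of_ne (fun h => ?_) huv
    have := Fin.ext_iff.1 (e₁.injective (h₁.trans h))
    simp only at this
    lia
  have h₃ : e₂ ⟨n - 1, by lia⟩ = v := by simp [e₂]
  have hinj : Set.InjOn (fun i => if h : i < n then e₂ ⟨i, h⟩ else u) (Set.Iio n) := by
    intro i hi j hj h
    simp only [Set.mem_Iio] at hi hj
    simpa [hi, hj] using h
  refine ⟨fun i => if h : i < n then e₂ ⟨i, h⟩ else u, hinj, ?_, ?_, fun i hi => ?_⟩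
  · simp [h₂]
  · simp [h₃, show n - 1 < n by lia]
  · rw [top_adj]
    intro h
    have := hinj (show i < n by lia) hi h
    lia

open Classical in
theorem degree_eq_card_filter_range {p : ℕ → V} (hinj : Set.InjOn p (Set.Iio n))
    (hV : Fintype.card V = n) (x : V) :
    G.degree x = ((Finset.range n).filter fun i => G.Adj x (p i)).card := by
  rw [← card_neighborFinset_eq_degree, eq_comm]
  refine Finset.card_bij (fun i _ => p i) (fun i hi => ?_) (fun i hi j hj h => ?_) fun a ha => ?_
  · simpa using (Finset.mem_filter.1 hi).2
  · exact hinj (by simpa using (Finset.mem_filter.1 hi).1)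
      (by simpa using (Finset.mem_filter.1 hj).1) h
  · obtain ⟨i, hi, rfl⟩ := exists_lt_apply_eq_of_injOn hinj hV a
    exact ⟨i, Finset.mem_filter.2 ⟨Finset.mem_range.2 hi, by simpa using ha⟩, rfl⟩

open Classical in
/-- Ore's counting argument. If the step from `p i` to `p (i + 1)` is the only one that is not an edge,
and there is no Hamiltonian path from `u` to `v`, then the neighbours of `p i`, shifted by one along
the sequence, avoid the neighbours of `p (i + 1)`. The last position has no shift, which costs `1`;
this is recovered when the missing edge is the first or the last step. -/
theorem degree_add_degree_le_of_not_exists_isHamiltonianSeq {p : ℕ → V} {i : ℕ}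
    (hV : Fintype.card V = n) (hG : ¬ ∃ p, G.IsHamiltonianSeq u v n p)
    (hinj : Set.InjOn p (Set.Iio n)) (h0 : p 0 = u) (h1 : p (n - 1) = v)
    (hi : i + 1 < n) (hxy : ¬ G.Adj (p i) (p (i + 1)))
    (hadj : ∀ j, j + 1 < n → j ≠ i → G.Adj (p j) (p (j + 1))) :
    G.degree (p i) + G.degree (p (i + 1)) ≤ n ∧
      (i = 0 ∨ i + 1 = n - 1 → G.degree (p i) + G.degree (p (i + 1)) ≤ n - 1) := by
  set S := (Finset.range n).filter fun j => G.Adj (p i) (p j) with hS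
  set T := (Finset.range n).filter fun j => G.Adj (p (i + 1)) (p j) with hT
  rw [degree_eq_card_filter_range hinj hV, degree_eq_card_filter_range hinj hV, ← hS, ← hT]
  -- A crossing pair of chords at `j` reroutes the sequence around its missing edge.
  have hcross : ∀ j, j + 1 < n → j ∈ S → j + 1 ∉ T := by
    intro j hj hjS hjT
    have hjS := (Finset.mem_filter.1 hjS).2
    have hjT := (Finset.mem_filter.1 hjT).2
    rcases lt_trichotomy j i with h | rfl | h
    · refine hG ⟨_, isHamiltonianSeq_reverse_segment (a := j + 1) (b := i) hinj h0 h1 (by lia)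
        (by lia) hi (fun l hl _ hli => hadj l hl hli) ?_ hjT.symm⟩
      simpa using hjS.symm
    · exact G.irrefl hjS
    · rcases Nat.eq_or_lt_of_le h with h | h
      · exact hxy (by rwa [← h] at hjS)
      · exact hG ⟨_, isHamiltonianSeq_reverse_segment (a := i + 1) (b := j) hinj h0 h1 (by lia)
          (by lia) hj (fun l hl hli _ => hadj l hl (by lia)) (by simpa using hjS) hjT⟩
  set S' := (S.erase (n - 1)).image (· + 1) with hS'
  have hS'c : S'.card = (S.erase (n - 1)).card :=
    Finset.card_image_of_injective _ (add_left_injective 1)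
  have hmem : ∀ j ∈ S', ∃ l, l + 1 < n ∧ l ∈ S ∧ j = l + 1 := by
    intro j hj
    obtain ⟨l, hl, rfl⟩ := Finset.mem_image.1 hj
    have hl' := Finset.mem_erase.1 hl
    have := Finset.mem_range.1 (Finset.mem_filter.1 hl'.2).1
    exact ⟨l, by lia, hl'.2, rfl⟩
  have hdisj : Disjoint S' T := Finset.disjoint_left.2 fun j hj => by
    obtain ⟨l, hl, hlS, rfl⟩ := hmem j hj
    exact hcross l hl hlS
  have hiS : i ∉ S := fun h => G.irrefl (Finset.mem_filter.1 h).2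
  have hi1S : i + 1 ∉ S := fun h => hxy (Finset.mem_filter.1 h).2
  have hiT : i ∉ T := fun h => hxy (Finset.mem_filter.1 h).2.symm
  have hi1T : i + 1 ∉ T := fun h => G.irrefl (Finset.mem_filter.1 h).2
  have hsub : S' ∪ T ⊆ (Finset.range n).erase (i + 1) := by
    intro j hj
    rcases Finset.mem_union.1 hj with hj | hj
    · obtain ⟨l, hl, hlS, rfl⟩ := hmem j hj
      exact Finset.mem_erase.2 ⟨fun h => hiS (by rwa [show i = l by lia]), by simpa using hl⟩
    · exact Finset.mem_erase.2 ⟨fun h => hi1T (h ▸ hj), (Finset.mem_filter.1 hj).1⟩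
  have hcard : (S.erase (n - 1)).card + T.card = (S' ∪ T).card := by
    rw [Finset.card_union_of_disjoint hdisj, hS'c]
  have hle := Finset.card_le_card hsub
  rw [Finset.card_erase_of_mem (by simpa using hi), Finset.card_range] at hle
  have hpred := Finset.pred_card_le_card_erase (s := S) (a := n - 1)
  refine ⟨by lia, ?_⟩
  rintro (rfl | hlast)
  · have h0mem : 0 ∉ S' ∪ T := fun h => by
      rcases Finset.mem_union.1 h with h | h
      · obtain ⟨l, -, -, hl⟩ := hmem 0 h
        lia
      · exact hiT h
    have hsub' : S' ∪ T ⊆ ((Finset.range n).erase (0 + 1)).erase 0 :=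
      fun j hj => Finset.mem_erase.2 ⟨fun h => h0mem (h ▸ hj), hsub hj⟩
    have hle' := Finset.card_le_card hsub'
    rw [Finset.card_erase_of_mem (Finset.mem_erase.2 ⟨by lia, by simp; lia⟩),
      Finset.card_erase_of_mem (by simpa using hi), Finset.card_range] at hle'
    lia
  · rw [Finset.erase_eq_of_notMem (by rwa [← hlast])] at hcard
    lia

open Classical in
/-- A graph with no Hamiltonian path from `u` to `v` lies in a saturated one, in which nonadjacent
vertices have degree sum at most `n`, and at most `n - 1` if one of them is `u` or `v`. -/
theorem exists_ge_ne_top_degree_add_degree_le (huv : u ≠ v) (hV : Fintype.card V = n)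
    (hG : ¬ ∃ p, G.IsHamiltonianSeq u v n p) :
    ∃ H : SimpleGraph V, G ≤ H ∧ H ≠ ⊤ ∧ ∀ x y, x ≠ y → ¬ H.Adj x y →
      H.degree x + H.degree y ≤ n ∧
        (x = u ∨ x = v → H.degree x + H.degree y ≤ n - 1) := by
  obtain ⟨H, hGH, hH⟩ := (Set.toFinite
    {H : SimpleGraph V | ¬ ∃ p, H.IsHamiltonianSeq u v n p}).exists_le_maximal hG
  refine ⟨H, hGH, fun h => hH.prop (h ▸ exists_isHamiltonianSeq_top huv hV),
    fun x y hxy hnadj => ?_⟩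
  have hex : ∃ p, (H ⊔ edge x y).IsHamiltonianSeq u v n p := by
    by_contra h
    exact (lt_sup_edge H x y hxy hnadj).not_ge (hH.le_of_ge h le_sup_left)
  obtain ⟨p, hp⟩ := hex
  have hbad : ∃ i, i + 1 < n ∧ ¬ H.Adj (p i) (p (i + 1)) := by
    by_contra! h
    exact hH.prop ⟨p, hp.injOn, hp.first, hp.last, h⟩
  obtain ⟨i, hi, hbad⟩ := hbad
  have hends : ∀ j, j + 1 < n → ¬ H.Adj (p j) (p (j + 1)) →
      (p j = x ∧ p (j + 1) = y) ∨ (p j = y ∧ p (j + 1) = x) := fun j hj h => by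
    have := hp.adj j hj
    rw [sup_adj, edge_adj] at this
    exact (this.resolve_left h).1
  have hinj : ∀ j l, j < n → l < n → p j = p l → j = l := fun j l hj hl h => hp.injOn hj hl h
  have hadj : ∀ j, j + 1 < n → j ≠ i → H.Adj (p j) (p (j + 1)) := by
    intro j hj hji
    by_contra h
    rcases hends j hj h with ⟨h₁, h₂⟩ | ⟨h₁, h₂⟩ <;>
      rcases hends i hi hbad with ⟨h₃, h₄⟩ | ⟨h₃, h₄⟩
    · exact hji (hinj _ _ (by lia) (by lia) (h₁.trans h₃.symm))
    · have := hinj _ _ (by lia) (by lia) (h₁.trans h₄.symm)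
      have := hinj _ _ (by lia) (by lia) (h₂.trans h₃.symm)
      lia
    · have := hinj _ _ (by lia) (by lia) (h₁.trans h₄.symm)
      have := hinj _ _ (by lia) (by lia) (h₂.trans h₃.symm)
      lia
    · exact hji (hinj _ _ (by lia) (by lia) (h₁.trans h₃.symm))
  have hmain := degree_add_degree_le_of_not_exists_isHamiltonianSeq hV hH.prop hp.injOn hp.first
    hp.last hi hbad hadj
  -- An end of the sequence can only meet the missing edge when that edge is first or last.
  have hend : x = u ∨ x = v → i = 0 ∨ i + 1 = n - 1 := by
    rintro (h | h)
    · rw [← hp.first] at h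
      rcases hends i hi hbad with ⟨h₁, -⟩ | ⟨-, h₂⟩
      · exact .inl (hinj _ _ (by lia) (by lia) (h₁.trans h))
      · have := hinj _ _ (by lia) (by lia) (h₂.trans h)
        lia
    · rw [← hp.last] at h
      rcases hends i hi hbad with ⟨h₁, -⟩ | ⟨-, h₂⟩
      · have := hinj _ _ (by lia) (by lia) (h₁.trans h)
        lia
      · exact .inr (hinj _ _ (by lia) (by lia) (h₂.trans h))
  have hsum : H.degree (p i) + H.degree (p (i + 1)) = H.degree x + H.degree y := by
    rcases hends i hi hbad with ⟨h₁, h₂⟩ | ⟨h₁, h₂⟩ <;> rw [h₁, h₂]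
    exact add_comm _ _
  rw [hsum] at hmain
  exact ⟨hmain.1, fun h => hmain.2 (hend h)⟩

end Fintype

/-! ### Recognizing joins -/

/-- The isomorphism of joins induced by isomorphisms of the two sides. -/
def Iso.joinCongr {V W V' W' : Type*} {G : SimpleGraph V} {H : SimpleGraph W}
    {G' : SimpleGraph V'} {H' : SimpleGraph W'} (f : G ≃g G') (g : H ≃g H') :
    G.join H ≃g G'.join H' where
  toEquiv := f.toEquiv.sumCongr g.toEquiv
  map_rel_iff' := by
    rintro (a | a) (b | b) <;> simp [join, completeBipartiteGraph, f.map_adj_iff, g.map_adj_iff]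

theorem exists_iso_join_induce {V : Type*} {G : SimpleGraph V} (W : Set V)
    (h : ∀ a ∈ W, ∀ b ∉ W, G.Adj a b) :
    ∃ φ : G ≃g (G.induce W).join (G.induce Wᶜ), ∀ i, φ.symm (.inl i) = i := by
  classical
  let ψ : (G.induce W).join (G.induce Wᶜ) ≃g G :=
    { toEquiv := Equiv.Set.sumCompl W
      map_rel_iff' := by
        rintro (⟨a, ha⟩ | ⟨a, ha⟩) (⟨b, hb⟩ | ⟨b, hb⟩)
        · simp [join, completeBipartiteGraph]
        · simp [join, completeBipartiteGraph, h a ha b hb]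
        · simp [join, completeBipartiteGraph, (h b hb a ha).symm]
        · simp [join, completeBipartiteGraph] }
  exact ⟨ψ.symm, fun i => rfl⟩

theorem degree_join_inl {V W : Type*} [Fintype W] (G : SimpleGraph V) (H : SimpleGraph W) (a : V)
    [Fintype (G.neighborSet a)] [Fintype ((G.join H).neighborSet (.inl a))] :
    (G.join H).degree (.inl a) = G.degree a + Fintype.card W := by
  have : (G.join H).neighborFinset (.inl a) =
      (G.neighborFinset a).disjSum (Finset.univ : Finset W) := by
    ext (b | b) <;> rw [mem_neighborFinset] <;> simp [join, completeBipartiteGraph]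
  rw [← card_neighborFinset_eq_degree, this, Finset.card_disjSum, card_neighborFinset_eq_degree,
    Finset.card_univ]

theorem nonempty_iso_sum_top {V : Type*} [Finite V] {G : SimpleGraph V} {P : Set V} {a b : ℕ}
    (hG : ∀ x y, G.Adj x y ↔ x ≠ y ∧ (x ∈ P ↔ y ∈ P)) (ha : Nat.card P = a)
    (hb : Nat.card ↥Pᶜ = b) :
    Nonempty (G ≃g (⊤ : SimpleGraph (Fin a)) ⊕g (⊤ : SimpleGraph (Fin b))) := by
  classical
  let ψ : (⊤ : SimpleGraph P) ⊕g (⊤ : SimpleGraph ↥Pᶜ) ≃g G :=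
    { toEquiv := Equiv.Set.sumCompl P
      map_rel_iff' := by
        rintro (⟨x, hx⟩ | ⟨x, hx⟩) (⟨y, hy⟩ | ⟨y, hy⟩)
        · simp [hG, hx, hy]
        · have hy : y ∉ P := hy
          simp [hG, hx, hy]
        · have hx : x ∉ P := hx
          simp [hG, hx, hy]
        · have hx : x ∉ P := hx
          have hy : y ∉ P := hy
          simp [hG, hx, hy] }
  exact ⟨ψ.symm.trans (Iso.sumCongr (.completeGraph (Finite.equivFinOfCardEq ha))
    (.completeGraph (Finite.equivFinOfCardEq hb)))⟩

open Classical in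
/-- If every vertex of `W` has degree `n / 2` and is adjacent to everything outside `W`, then `G` is in
the family `ES_n`, with `G₁` induced by `W` and `r` the number of vertices outside `W`. -/
theorem memES_of_regular {V : Type*} [Fintype V] {G : SimpleGraph V} {n k : ℕ} (W : Set V)
    (hV : Fintype.card V = n) (hn : n = 2 * k) (hW : ∀ a ∈ W, ∀ b ∉ W, G.Adj a b)
    (hdeg : ∀ a ∈ W, G.degree a = k) (hk : k ≤ Nat.card W) (hne : Wᶜ.Nonempty) : G.MemES n := by
  have hsum : Nat.card W + Nat.card ↥Wᶜ = n := by
    rw [Nat.card_coe_set_eq, Nat.card_coe_set_eq, Set.ncard_add_ncard_compl,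
      Nat.card_eq_fintype_card, hV]
  have hpos : 0 < Nat.card ↥Wᶜ := by
    have := hne.to_subtype
    exact Nat.card_pos
  obtain ⟨φ, hφ⟩ := exists_iso_join_induce W hW
  set r := Nat.card ↥Wᶜ with hr
  have h₁ : Fintype.card W = n - r := by rw [← Nat.card_eq_fintype_card]; lia
  have h₂ : Fintype.card ↥Wᶜ = r := by rw [← Nat.card_eq_fintype_card]
  refine ⟨⟨k, by lia⟩, .inr ⟨r, hpos, by lia, (G.induce W).overFin h₁, (G.induce Wᶜ).overFin h₂,
    fun i => ?_, ⟨φ.trans (Iso.joinCongr (overFinIso _ h₁) (overFinIso _ h₂))⟩⟩⟩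
  have hd : ∀ w : W, (G.induce W).degree w + Fintype.card ↥Wᶜ = k := fun w => by
    rw [← degree_join_inl (G.induce W) (G.induce Wᶜ), ← φ.symm.degree_eq, hφ]
    exact hdeg _ w.2
  have := hd (((G.induce W).overFinIso h₁).symm i)
  rw [← Iso.degree_eq ((G.induce W).overFinIso h₁).symm]
  lia

/-- Among the pairs `x, y ≤ q` with `x + y ≥ p + q`, the product is least exactly when
`{x, y} = {p, q}`. Here `xy - pq = (x - p) y - p (q - y)`. -/
theorem mul_le_mul_and_eq_of_add_le_add {p q x y : ℕ} (hp : 0 < p) (hx : x ≤ q) (hy : y ≤ q)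
    (hxy : p + q ≤ x + y) :
    p * q ≤ x * y ∧ (x * y = p * q → x + y = p + q ∧ (x = p ∨ x = q)) := by
  obtain ⟨a, rfl⟩ := Nat.exists_eq_add_of_le (show p ≤ x by lia)
  obtain ⟨b, rfl⟩ := Nat.exists_eq_add_of_le hy
  obtain ⟨c, rfl⟩ := Nat.exists_eq_add_of_le (show b ≤ a by lia)
  obtain ⟨d, rfl⟩ := Nat.exists_eq_add_of_le (show p ≤ y by lia)
  -- With `y = p + d`, `q = y + b` and `x = p + b + c`, the difference `xy - pq` is `pc + (b + c)d`.
  have key : (p + (b + c)) * (p + d) = p * (p + d + b) + (p * c + (b + c) * d) := by ring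
  refine ⟨by lia, fun h => ?_⟩
  have h0 : p * c = 0 ∧ (b + c) * d = 0 := by lia
  have hc : c = 0 := by simpa [hp.ne'] using h0.1
  subst hc
  have := h0.2
  simp only [add_zero, mul_eq_zero] at this
  lia

open Classical in
/-- A graph whose complement is the complete bipartite graph between `T` and `S`, up to an edge between
the two remaining vertices `u` and `v`, is `(K_p + K_q) ∨ K_2` or `(K_p + K_q) ∨ O_2`. -/
theorem nonempty_iso_join_of_complete_bipartite_compl {V : Type*} [Fintype V] {G : SimpleGraph V}
    {S T : Set V} {u v : V} {p q : ℕ} (huv : u ≠ v) (hST : Disjoint T S)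
    (hR : (T ∪ S)ᶜ = {u, v}) (hT : Nat.card T = p) (hS : Nat.card S = q)
    (hadj : ∀ a ∈ T ∪ S, ∀ b, G.Adj a b ↔ a ≠ b ∧ ¬ (a ∈ T ∧ b ∈ S ∨ a ∈ S ∧ b ∈ T)) :
    Nonempty (G ≃g ((⊤ : SimpleGraph (Fin p)) ⊕g (⊤ : SimpleGraph (Fin q))).join
        (⊤ : SimpleGraph (Fin 2))) ∨
      Nonempty (G ≃g ((⊤ : SimpleGraph (Fin p)) ⊕g (⊤ : SimpleGraph (Fin q))).join
        (⊥ : SimpleGraph (Fin 2))) := by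
  have hdisj : ∀ x, x ∈ T → x ∉ S := fun x h => Set.disjoint_left.1 hST h
  obtain ⟨φ, -⟩ := exists_iso_join_induce (G := G) (T ∪ S) fun a ha b hb => by
    rw [hadj a ha]
    refine ⟨fun h => hb (h ▸ ha), ?_⟩
    rintro (⟨-, h⟩ | ⟨-, h⟩)
    exacts [hb (.inr h), hb (.inl h)]
  obtain ⟨ψ⟩ := nonempty_iso_sum_top (G := G.induce (T ∪ S)) (P := {w | (w : V) ∈ T})
    (a := p) (b := q) (by
      rintro ⟨x, hx⟩ ⟨y, hy⟩
      have h₁ := hdisj x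
      have h₂ := hdisj y
      simp only [comap_adj, Function.Embedding.subtype_apply, hadj x hx, Set.mem_ofPred_eq,
        ne_eq, Subtype.mk.injEq]
      simp only [Set.mem_union] at hx hy
      tauto)
    (by
      rw [← hT, Nat.card_coe_set_eq, Nat.card_coe_set_eq,
        ← Set.ncard_image_of_injective _ Subtype.val_injective]
      congr 1
      ext x
      simp +contextual)
    (by
      rw [← hS, Nat.card_coe_set_eq, Nat.card_coe_set_eq,
        ← Set.ncard_image_of_injective _ Subtype.val_injective]
      congr 1
      ext x
      have := hdisj x
      simp
      tauto)
  have h2 : Nat.card ↥(T ∪ S)ᶜ = 2 := by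
    rw [Nat.card_coe_set_eq, hR, Set.ncard_pair huv]
  let e := Finite.equivFinOfCardEq h2
  have hmem : ∀ x : ↥(T ∪ S)ᶜ, (x : V) = u ∨ (x : V) = v := fun x => by
    simpa using hR.subset x.2
  by_cases h : G.Adj u v
  · refine .inl ⟨φ.trans (ψ.joinCongr ⟨e, ?_⟩)⟩
    intro a b
    have hab : (a : V) = b ↔ a = b := Subtype.ext_iff.symm
    rcases hmem a with ha | ha <;> rcases hmem b with hb | hb <;>
      simp [← hab, ha, hb, h, h.symm, huv, huv.symm]
  · refine .inr ⟨φ.trans (ψ.joinCongr ⟨e, ?_⟩)⟩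
    intro a b
    have h' : ¬ G.Adj v u := fun h' => h h'.symm
    rcases hmem a with ha | ha <;> rcases hmem b with hb | hb <;> simp [ha, hb, h, h']

end SimpleGraph

/-! ### The extremal graphs -/

theorem theorem2p12 {V : Type*} [Fintype V] (G : SimpleGraph V) [DecidableRel G.Adj] (n k : ℕ)
    (hk : 2 ≤ k) (hn : 2 * k ≤ n) (hV : Fintype.card V = n) (hδ : k ≤ G.minDegree)
    (hμ : Gᶜ.adjSpectralRadius ≤ Real.sqrt (((k : ℝ) - 1) * ((n : ℝ) - (k : ℝ) - 1))) :
    G.IsHamiltonConnected ∨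
      Nonempty (G ≃g SimpleGraph.join
        ((⊤ : SimpleGraph (Fin (k - 1))) ⊕g (⊤ : SimpleGraph (Fin (n - k - 1))))
        (⊤ : SimpleGraph (Fin 2))) ∨
      Nonempty (G ≃g SimpleGraph.join
        ((⊤ : SimpleGraph (Fin (k - 1))) ⊕g (⊤ : SimpleGraph (Fin (n - k - 1))))
        (⊥ : SimpleGraph (Fin 2))) ∨
      (n = 2 * k ∧ G.MemES n) := by
  rw [or_iff_not_imp_left]
  intro hG
  rw [SimpleGraph.IsHamiltonConnected] at hG
  push Not at hG
  obtain ⟨u, v, huv, hG⟩ := hG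
  have hδ' : ∀ a, k ≤ G.degree a := fun a => hδ.trans (G.minDegree_le_degree a)
  obtain ⟨H, hGH, hHtop, hH⟩ := SimpleGraph.exists_ge_ne_top_degree_add_degree_le huv hV
    (G := G) (by
      rintro ⟨p, hp⟩
      obtain ⟨w, hw⟩ := hp.exists_isHamiltonian hV
      exact hG w hw)
  classical
  have hBA : Hᶜ ≤ Gᶜ := compl_le_compl hGH
  -- Degree sums in the saturated graph, read in its complement.
  have hH' : ∀ a b, Hᶜ.Adj a b → n - 2 ≤ Hᶜ.degree a + Hᶜ.degree b ∧
      (a = u ∨ a = v → n - 1 ≤ Hᶜ.degree a + Hᶜ.degree b) := by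
    intro a b hab
    obtain ⟨hne, hnadj⟩ := (H.compl_adj a b).1 hab
    have h := hH a b hne hnadj
    have ha := H.degree_lt_card_verts a
    have hb := H.degree_lt_card_verts b
    rw [SimpleGraph.degree_compl, SimpleGraph.degree_compl, hV]
    rw [hV] at ha hb
    simp only [← SimpleGraph.card_neighborSet_eq_degree, Fintype.card_eq_nat_card] at h ha hb ⊢
    exact ⟨by lia, fun hu => by have := h.2 hu; lia⟩
  have hle : ∀ a, Hᶜ.degree a ≤ n - k - 1 := fun a => by
    have h₁ : Hᶜ.degree a ≤ Gᶜ.degree a := SimpleGraph.degree_le_of_le hBA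
    have h₂ := hδ' a
    rw [G.degree_compl, hV] at h₁
    lia
  have hpq : k - 1 + (n - k - 1) = n - 2 := by lia
  have harith : ∀ a b, Hᶜ.Adj a b → _ := fun a b hab =>
    SimpleGraph.mul_le_mul_and_eq_of_add_le_add (p := k - 1) (q := n - k - 1) (by lia) (hle a) (hle b)
      (hpq ▸ (hH' a b hab).1)
  have hs : √(((k : ℝ) - 1) * ((n : ℝ) - (k : ℝ) - 1)) ^ 2 = ((k - 1) * (n - k - 1) : ℕ) := by
    have h₁ : ((k - 1 : ℕ) : ℝ) = k - 1 := by rw [Nat.cast_sub (by lia)]; simp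
    have h₂ : ((n - k - 1 : ℕ) : ℝ) = n - k - 1 := by
      rw [Nat.cast_sub (by lia), Nat.cast_sub (by lia)]; simp
    rw [← h₁, ← h₂, Real.sq_sqrt (by positivity)]
    push_cast
    rfl
  obtain ⟨heq, hadj⟩ := SimpleGraph.degree_mul_degree_eq_and_adj_of_adjSpectralRadius_le hBA
    (Real.sqrt_nonneg _) hμ fun a b hab => by
      rw [hs, ← Nat.cast_mul, Nat.cast_le]
      convert (harith a b hab).1
  rw [hs] at heq
  have hdeg : ∀ a b, Hᶜ.Adj a b → Hᶜ.degree a + Hᶜ.degree b = n - 2 ∧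
      (Hᶜ.degree a = k - 1 ∨ Hᶜ.degree a = n - k - 1) := fun a b hab => by
    rw [← hpq]
    refine (harith a b hab).2 ?_
    have := heq a b hab
    rw [← Nat.cast_mul, Nat.cast_inj] at this
    convert this
  replace hadj : ∀ a b, Gᶜ.Adj a b → 0 < Hᶜ.degree a → Hᶜ.Adj a b := fun a b hab h =>
    hadj a b hab (by convert h)
  have hpos : ∀ a b, Hᶜ.Adj a b → 0 < Hᶜ.degree a := fun a b hab =>
    (SimpleGraph.degree_pos_iff_exists_adj _ _).2 ⟨b, hab⟩
  -- At `u` and `v` the degree sums along edges would exceed `n - 2`, so these two are isolated.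
  have huv0 : ∀ a, a = u ∨ a = v → Hᶜ.degree a = 0 := by
    intro a ha
    by_contra h
    obtain ⟨b, hab⟩ := (SimpleGraph.degree_pos_iff_exists_adj _ _).1 (Nat.pos_of_ne_zero h)
    have h₁ := (hdeg a b hab).1
    have h₂ := (hH' a b hab).2 ha
    lia
  obtain ⟨x, y, hxy⟩ : ∃ x y, Hᶜ.Adj x y := by
    by_contra! h
    exact hHtop (by
      rw [← compl_compl H, ← compl_bot]
      congr 1
      ext a b
      simpa using h a b)
  by_cases hnk : n = 2 * k
  -- Here `k - 1 = n - k - 1`, so the vertices not isolated in `Hᶜ` induce a regular graph.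
  · refine .inr (.inr ⟨hnk, ?_⟩)
    refine SimpleGraph.memES_of_regular {a | 0 < Hᶜ.degree a} hV hnk (fun a ha b hb => ?_)
      (fun a ha => ?_) ?_ ⟨u, by simp [huv0 u (.inl rfl)]⟩
    · by_contra h
      have : Gᶜ.Adj a b := (G.compl_adj a b).2 ⟨fun h => hb (h ▸ ha), h⟩
      exact hb (hpos _ _ (hadj a b this ha).symm)
    · obtain ⟨b, hab⟩ := (SimpleGraph.degree_pos_iff_exists_adj _ _).1 ha
      have h₁ := (hdeg a b hab).2
      have h₂ : Gᶜ.degree a = Hᶜ.degree a := by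
        rw [← SimpleGraph.card_neighborFinset_eq_degree, ← SimpleGraph.card_neighborFinset_eq_degree]
        congr 1
        ext c
        simp only [SimpleGraph.mem_neighborFinset]
        exact ⟨fun h => hadj a c h ha, fun h => hBA h⟩
      rw [G.degree_compl, hV] at h₂
      have h₃ := G.degree_lt_card_verts a
      have h₄ : G.degree a = k := by lia
      convert h₄
    · have hsub : insert x (Hᶜ.neighborSet x) ⊆ {a | 0 < Hᶜ.degree a} := by
        rintro a (rfl | ha)
        · exact hpos _ _ hxy
        · exact hpos _ _ (SimpleGraph.Adj.symm ha)
      have h₁ := Set.ncard_le_ncard hsub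
      rw [Set.ncard_insert_of_notMem (by simp), ← Nat.card_coe_set_eq, Nat.card_eq_fintype_card,
        SimpleGraph.card_neighborSet_eq_degree, ← Nat.card_coe_set_eq] at h₁
      have := (hdeg x y hxy).2
      lia
  -- Here `k - 1 < n - k - 1`, so every edge of `Hᶜ` joins vertices of the two different degrees.
  · rw [← or_assoc]
    refine .inl ?_
    obtain ⟨x, y, hxy, hx⟩ : ∃ x y, Hᶜ.Adj x y ∧ Hᶜ.degree x = k - 1 := by
      rcases (hdeg x y hxy).2 with h | h
      · exact ⟨x, y, hxy, h⟩
      · exact ⟨y, x, hxy.symm, by have := (hdeg x y hxy).1; lia⟩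
    have hy : Hᶜ.degree y = n - k - 1 := by have := (hdeg x y hxy).1; lia
    have hT : ∀ a, Hᶜ.Adj x a → Hᶜ.degree a = n - k - 1 := fun a ha => by
      have := (hdeg x a ha).1
      lia
    have hS : ∀ a, Hᶜ.Adj y a → Hᶜ.degree a = k - 1 := fun a ha => by
      have := (hdeg y a ha).1
      lia
    have hTS : Disjoint (Hᶜ.neighborFinset x) (Hᶜ.neighborFinset y) := by
      refine Finset.disjoint_left.2 fun a h₁ h₂ => ?_
      have h₁ := hT a (by simpa using h₁)
      have h₂ := hS a (by simpa using h₂)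
      lia
    -- The two neighbourhoods have `n - 2` elements in total, and miss both `u` and `v`.
    have huniv : (Hᶜ.neighborFinset x ∪ Hᶜ.neighborFinset y)ᶜ = {u, v} := by
      symm
      refine Finset.eq_of_subset_of_card_le (fun a ha => ?_) ?_
      · have h0 := huv0 a (by simpa using ha)
        simp only [Finset.mem_compl, Finset.mem_union, SimpleGraph.mem_neighborFinset, not_or]
        exact ⟨fun h => (hpos _ _ h.symm).ne' h0, fun h => (hpos _ _ h.symm).ne' h0⟩
      · rw [Finset.card_compl, Finset.card_union_of_disjoint hTS,
          SimpleGraph.card_neighborFinset_eq_degree, SimpleGraph.card_neighborFinset_eq_degree,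
          hV, Finset.card_pair huv]
        lia
    have hcover : ∀ a, 0 < Hᶜ.degree a → Hᶜ.Adj x a ∨ Hᶜ.Adj y a := fun a ha => by
      by_contra h
      have : a ∈ (Hᶜ.neighborFinset x ∪ Hᶜ.neighborFinset y)ᶜ := by simpa using h
      rw [huniv] at this
      have := huv0 a (by simpa using this)
      lia
    have hcross : ∀ a b, Hᶜ.Adj a b →
        Hᶜ.Adj x a ∧ Hᶜ.Adj y b ∨ Hᶜ.Adj y a ∧ Hᶜ.Adj x b := fun a b hab => by
      have h := (hdeg a b hab).1
      rcases hcover a (hpos _ _ hab) with ha | ha <;>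
        rcases hcover b (hpos _ _ hab.symm) with hb | hb
      · have := hT a ha
        have := hT b hb
        lia
      · exact .inl ⟨ha, hb⟩
      · exact .inr ⟨ha, hb⟩
      · have := hS a ha
        have := hS b hb
        lia
    have hcomplete : ∀ a b, Hᶜ.Adj x a → Hᶜ.Adj y b → Hᶜ.Adj a b := fun a b ha hb => by
      have hsub : Hᶜ.neighborFinset a ⊆ Hᶜ.neighborFinset y := fun c hc => by
        have hc : Hᶜ.Adj a c := by simpa using hc
        rcases hcross a c hc with h | h
        · simpa using h.2
        · exact absurd (hT a ha) (by have := hS a h.1; lia)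
      have heq := Finset.eq_of_subset_of_card_le hsub (by
        rw [SimpleGraph.card_neighborFinset_eq_degree, SimpleGraph.card_neighborFinset_eq_degree,
          hT a ha, hy])
      have : b ∈ Hᶜ.neighborFinset a := heq ▸ (by simpa using hb)
      simpa using this
    refine SimpleGraph.nonempty_iso_join_of_complete_bipartite_compl
      (T := Hᶜ.neighborSet x) (S := Hᶜ.neighborSet y) huv ?_ ?_ ?_ ?_ fun a ha b => ?_
    · have := Finset.disjoint_coe.2 hTS
      simpa using this
    · have := congrArg (fun s : Finset V => (s : Set V)) huniv
      simpa using this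
    · rw [Nat.card_eq_fintype_card, SimpleGraph.card_neighborSet_eq_degree, hx]
    · rw [Nat.card_eq_fintype_card, SimpleGraph.card_neighborSet_eq_degree, hy]
    · have ha0 : 0 < Hᶜ.degree a := by
        rcases ha with ha | ha <;> exact hpos _ _ (SimpleGraph.Adj.symm ha)
      have hGH' : Gᶜ.Adj a b ↔ Hᶜ.Adj a b := ⟨fun h => hadj a b h ha0, fun h => hBA h⟩
      have hB : Hᶜ.Adj a b ↔ Hᶜ.Adj x a ∧ Hᶜ.Adj y b ∨ Hᶜ.Adj y a ∧ Hᶜ.Adj x b :=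
        ⟨hcross a b, by
          rintro (⟨h₁, h₂⟩ | ⟨h₁, h₂⟩)
          exacts [hcomplete a b h₁ h₂, (hcomplete b a h₂ h₁).symm]⟩
      simp only [SimpleGraph.mem_neighborSet]
      rw [← hB, ← hGH', SimpleGraph.compl_adj]
      have : G.Adj a b → a ≠ b := fun h => h.ne
      tauto
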